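/- Let $G=\langle S,s_0,E,S_1,S_P,\delta\rangle$ be a Markov decision process: $S$ is a finite set of states, $s_0\in S$, $E\subseteq S\times S$ is a set of edges such that every state has an outgoing edge, $S$ is partitioned into the player-1 states $S_1$ and the probabilistic states $S_P$, and $\delta(s)$ is, for each $s\in S_P$, a probability distribution on $S$ with $\delta(s)(t)>0$ iff $(s,t)\in E$. A strategy $\pi$ assigns to every finite sequence of states ending in a state $s\in S_1$ a probability distribution on the successors of $s$; $\mathbb{E}_s^{\pi}$ is the expectation over the random play $\omega=\omega_0\omega_1\omega_2\ldots$ with $\omega_0=s$ that results from $\pi$. Let $p:S\to\mathbb{N}$ be a priority function and $r:S\to\mathbb{R}$ a reward function. Put $$\mathrm{Mean}[r](\omega)=\liminf_{n\to\infty}\frac1n\sum_{i=0}^{n-1}r(\omega_i),$$ let $\mathrm{MP}[p,r](\omega)=\mathrm{Mean}[r](\omega)$ if the least priority of the states that occur infinitely often in $\omega$ is even, and $\mathrm{MP}[p,r](\omega)=\bot$ otherwise. The expectation of an objective is $\bot$ (below every real number) if the objective takes the value $\bot$ with positive probability. Let $\mathrm{Val}_G(\mathrm{Mean}[r])(s)=\sup_{\pi}\mathbb{E}_s^{\pi}[\mathrm{Mean}[r]]$,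 where $\pi$ ranges over all strategies. Suppose that $S$ is an end component of $G$ (that is, $(S,E)$ is strongly connected) and that $\min_{s\in S}p(s)$ is even. Then for every $\varepsilon>0$ there is a finite-memory strategy $\pi_\varepsilon$ (a pure strategy that is represented by a finite-state machine reading the states of the play) such that for all states $s\in S$ $$\mathbb{E}_s^{\pi_\varepsilon}\big[\mathrm{MP}[p,r]\big]\ \ge\ \mathrm{Val}_G(\mathrm{Mean}[r])(s)-\varepsilon .$$ Moreover, $\pi_\varepsilon$ can be chosen to be played in rounds of a fixed length $n+\ell$, with $n=|S|$ and some $\ell\ge 1$: in each round one pure memoryless strategy is played for $n$ steps, and then another pure memoryless strategy is played for $\ell$ steps (the two strategies and $\ell$ are the same in all rounds and for all starting states). -/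

import Mathlib

open MeasureTheory ProbabilityTheory Filter

namespace MPP

/-- A Markov decision process over the state space `S`. The set `player` holds the player-1 states,
its complement the probabilistic states, on which `δ` gives the law of the successor. -/
structure MDP (S : Type*) where
  init : S
  E : S → S → Prop
  player : Set S
  δ : {s : S // s ∉ player} → PMF S
  edge_iff : ∀ (s : {s : S // s ∉ player}) (t : S), E s t ↔ 0 < δ s t
  exists_edge : ∀ s : S, ∃ t : S, E s t

namespace MDP

variable {S : Type*}

/-- A (randomized, history dependent) strategy of player 1: after the history `v`, in the player-1
state `s`, the law of the successor is `dist v s`. Only available moves may be prescribed. -/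
structure Strategy (G : MDP S) where
  dist : List S → {s : S // s ∈ G.player} → PMF S
  available : ∀ (v : List S) (s : {s : S // s ∈ G.player}) (t : S), 0 < dist v s t → G.E s t

/-- A pure memoryless strategy, as a choice of a successor in every player-1 state. -/
structure PureMemoryless (G : MDP S) where
  move : {s : S // s ∈ G.player} → S
  available : ∀ s : {s : S // s ∈ G.player}, G.E s (move s)

/-- A finite-state machine with input and output alphabet `S` that describes a strategy: `upd` is
its transition function and `out` its labeling function. -/
structure FiniteStateMachine (G : MDP S) where
  Q : Type
  finite : Finite Q
  q₀ : Q
  upd : Q → S → Q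
  out : Q → S → S
  available : ∀ (q : Q) (s : S), s ∈ G.player → G.E s (out q s)

/-- The pure strategy that a finite-state machine represents: the machine reads the history `v` from
its initial memory content, and then outputs the successor of the current state `s`. -/
noncomputable def FiniteStateMachine.strategy {G : MDP S} (M : G.FiniteStateMachine) :
    G.Strategy where
  dist v s := PMF.pure (M.out (v.foldl M.upd M.q₀) s)
  available v s t h := by
    have ht : t = M.out (v.foldl M.upd M.q₀) s := by
      by_contra hne
      simp [PMF.pure_apply, hne] at h
    rw [ht]
    exact M.available _ _ s.2

/-- A (pure) finite-memory strategy: one that is represented by a finite-state machine. -/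
def Strategy.IsFiniteMemory {G : MDP S} (π : G.Strategy) : Prop :=
  ∃ M : G.FiniteStateMachine, π = M.strategy

/-- The strategy that is played in rounds of `n + l` steps: in each round, `σ` is played for `n`
steps and then `τ` for `l` steps. The number of steps already made is the length of the history. -/
noncomputable def roundStrategy {G : MDP S} (n l : ℕ) (σ τ : G.PureMemoryless) : G.Strategy where
  dist v s := PMF.pure (if v.length % (n + l) < n then σ.move s else τ.move s)
  available v s t h := by
    have ht : t = if v.length % (n + l) < n then σ.move s else τ.move s := by
      by_contra hne
      simp only [PMF.pure_apply, hne, if_false, lt_self_iff_false] at h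
    rw [ht]
    split_ifs
    · exact σ.available s
    · exact τ.available s

open Classical in
/-- The law of the state number `k + 1` given the states number `0, …, k`. -/
noncomputable def stepDist (G : MDP S) (π : G.Strategy) (k : ℕ) (h : Finset.Iic k → S) : PMF S :=
  if hs : h ⟨k, Finset.mem_Iic.2 le_rfl⟩ ∈ G.player then
    π.dist (List.ofFn fun i : Fin k => h ⟨i, Finset.mem_Iic.2 i.2.le⟩) ⟨_, hs⟩
  else G.δ ⟨_, hs⟩

/-- `stepDist` as a Markov kernel. -/
noncomputable def stepKernel [Finite S] [MeasurableSpace S] [DiscreteMeasurableSpace S]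
    (G : MDP S) (π : G.Strategy) (k : ℕ) : Kernel (Finset.Iic k → S) S where
  toFun h := (G.stepDist π k h).toMeasure
  measurable' := measurable_of_countable _

instance [Finite S] [MeasurableSpace S] [DiscreteMeasurableSpace S]
    (G : MDP S) (π : G.Strategy) (k : ℕ) : IsMarkovKernel (G.stepKernel π k) :=
  ⟨fun h => PMF.toMeasure.isProbabilityMeasure (G.stepDist π k h)⟩

/-- The law `μ_s^π` of the random play that starts in `s` when player 1 follows `π`. -/
noncomputable def playMeasure [Finite S] [MeasurableSpace S] [DiscreteMeasurableSpace S]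
    (G : MDP S) (π : G.Strategy) (s : S) : Measure (ℕ → S) :=
  Kernel.traj (X := fun _ => S) (G.stepKernel π) 0 (fun _ => s)

open Classical in
/-- The expectation of an objective with values in `ℝ ∪ {⊥}`: it is `⊥` if the value `⊥` is taken
with positive probability. -/
noncomputable def expectation [Finite S] [MeasurableSpace S] [DiscreteMeasurableSpace S]
    (G : MDP S) (π : G.Strategy) (s : S) (f : (ℕ → S) → WithBot ℝ) : EReal :=
  if ∀ᵐ ω ∂G.playMeasure π s, f ω ≠ ⊥ then
    ((∫ ω, (f ω).unbotD 0 ∂G.playMeasure π s : ℝ) : EReal)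
  else ⊥

/-- The value of an objective: the supremum of its expectation over all strategies. -/
noncomputable def value [Finite S] [MeasurableSpace S] [DiscreteMeasurableSpace S]
    (G : MDP S) (f : (ℕ → S) → WithBot ℝ) (s : S) : EReal :=
  ⨆ π : G.Strategy, G.expectation π s f

/-- `U` is an end component: it is nonempty, no edge leaves it from a probabilistic state, and the
MDP restricted to `U` is strongly connected. (Paths have at least one edge, so that also in a
one-point `U` every state has a successor within `U`.) -/
def IsEndComponent (G : MDP S) (U : Set S) : Prop :=
  U.Nonempty ∧
  (∀ s ∈ U, s ∉ G.player → ∀ t, G.E s t → t ∈ U) ∧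
  ∀ s ∈ U, ∀ t ∈ U, Relation.TransGen (fun a b => a ∈ U ∧ b ∈ U ∧ G.E a b) s t

end MDP

variable {S : Type*}

/-- The set of states that a play visits infinitely often. -/
def infStates (ω : ℕ → S) : Set S := {q | ∀ i, ∃ j > i, ω j = q}

/-- The minimum priority in a set of states. -/
noncomputable def minPriority (p : S → ℕ) (U : Set S) : ℕ := sInf (p '' U)

/-- The long-run average of the rewards along a play. -/
noncomputable def limAvg (r : S → ℝ) (ω : ℕ → S) : ℝ :=
  liminf (fun n : ℕ => (1 / (n : ℝ)) * ∑ i ∈ Finset.range n, r (ω i)) atTop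

/-- The mean-payoff objective. -/
noncomputable def meanPayoff (r : S → ℝ) (ω : ℕ → S) : WithBot ℝ := (limAvg r ω : ℝ)

open Classical in
/-- The mean-payoff parity objective: `⊥` unless the least priority seen infinitely often is even. -/
noncomputable def meanPayoffParity (p : S → ℕ) (r : S → ℝ) (ω : ℕ → S) : WithBot ℝ :=
  if Even (minPriority p (infStates ω)) then meanPayoff r ω else ⊥

end MPP

/-! A constant `v` and a bias `h` are found with r + (best mean of `h` at the next state) = v + h up
to a small error. They come from a discounted value V: strong connectivity bounds max V - min V
uniformly in the discount factor (`exists_span_bound`), so a discount factor near 1 gives the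
equation (`exists_approx_optimality_equation`).

Summed along a play, the equation telescopes. What remains are deviations of `h` from its
conditional means; they are orthogonal and bounded, so their averages vanish almost surely
(`ae_tendsto_average_deviation`). Hence no strategy beats `v` by more than the error
(`ae_limAvg_le`), while a greedy memoryless `τ` attains `v` up to the error.

To secure parity, each round begins with n steps of `σ`, which moves towards a state `x` of least
priority. A round visits `x` with probability bounded below, so `x` recurs almost surely
(`ae_mem_infStates_roundStrategy`). Each step of `σ` costs a bounded amount, and a long `τ` phase
makes these steps rare (`ae_le_limAvg_roundStrategy`). -/

namespace MPP

/-! ### Means under a probability mass function. -/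

section Mean

variable {S : Type*} [Fintype S]

/-- The mean of a function under a probability mass function on a finite type. -/
noncomputable def mean (μ : PMF S) (f : S → ℝ) : ℝ := ∑ t, (μ t).toReal * f t

theorem sum_toReal_pmf (μ : PMF S) : ∑ t, (μ t).toReal = 1 := by
  rw [← ENNReal.toReal_sum fun t _ => μ.apply_ne_top t, ← tsum_fintype (L := .unconditional _),
    μ.tsum_coe, ENNReal.toReal_one]

theorem mean_mono {μ : PMF S} {f g : S → ℝ} (h : ∀ t, f t ≤ g t) : mean μ f ≤ mean μ g :=
  Finset.sum_le_sum fun t _ => mul_le_mul_of_nonneg_left (h t) ENNReal.toReal_nonneg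

theorem mean_const (μ : PMF S) (c : ℝ) : mean μ (fun _ => c) = c := by
  rw [mean, ← Finset.sum_mul, sum_toReal_pmf, one_mul]

theorem mean_add (μ : PMF S) (f g : S → ℝ) :
    mean μ (fun t => f t + g t) = mean μ f + mean μ g := by
  simp only [mean, mul_add, Finset.sum_add_distrib]

theorem mean_pure [DecidableEq S] (a : S) (f : S → ℝ) : mean (PMF.pure a) f = f a := by
  rw [mean, Finset.sum_eq_single a]
  · simp
  · intro b _ hb
    simp [PMF.pure_apply, hb]
  · simp

theorem mean_le {μ : PMF S} {f : S → ℝ} {c : ℝ} (h : ∀ t, f t ≤ c) : mean μ f ≤ c :=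
  (mean_mono h).trans_eq (mean_const μ c)

theorem le_mean {μ : PMF S} {f : S → ℝ} {c : ℝ} (h : ∀ t, c ≤ f t) : c ≤ mean μ f :=
  (mean_const μ c).symm.trans_le (mean_mono h)

theorem abs_mean_le {μ : PMF S} {f : S → ℝ} {c : ℝ} (h : ∀ t, |f t| ≤ c) : |mean μ f| ≤ c :=
  abs_le.2 ⟨le_mean fun t => (abs_le.1 (h t)).1, mean_le fun t => (abs_le.1 (h t)).2⟩

/-- After subtracting `b` all terms are nonnegative, so the one at `t` may be kept alone. -/
theorem add_mul_sub_le_mean {μ : PMF S} {f : S → ℝ} {b α : ℝ} (hb : ∀ t, b ≤ f t) (t : S)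
    (hα : α ≤ (μ t).toReal) : b + α * (f t - b) ≤ mean μ f := by
  have h1 : mean μ f = b + mean μ (fun t => f t - b) := by
    conv_lhs => rw [show f = fun t => b + (f t - b) from funext fun t => by ring]
    rw [mean_add, mean_const]
  have h2 : (μ t).toReal * (f t - b) ≤ mean μ (fun t => f t - b) :=
    Finset.single_le_sum (f := fun t => (μ t).toReal * (f t - b))
      (fun u _ => mul_nonneg ENNReal.toReal_nonneg (sub_nonneg.2 (hb u))) (Finset.mem_univ t)
  have h3 := mul_le_mul_of_nonneg_right hα (sub_nonneg.2 (hb t))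
  linarith

end Mean

namespace MDP

/-! ### One-step laws and the optimality operator. -/

section Laws

variable {S : Type*}

/-- The laws that may govern the next state when the current state is `s`. -/
def Admissible (G : MDP S) (s : S) (μ : PMF S) : Prop :=
  (s ∈ G.player → ∀ t, 0 < μ t → G.E s t) ∧ ∀ h : s ∉ G.player, μ = G.δ ⟨s, h⟩

open Classical in
/-- The law of the next state under a pure memoryless strategy. -/
noncomputable def PureMemoryless.law {G : MDP S} (σ : G.PureMemoryless) (s : S) : PMF S :=
  if h : s ∈ G.player then PMF.pure (σ.move ⟨s, h⟩) else G.δ ⟨s, h⟩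

theorem PureMemoryless.admissible_law {G : MDP S} (σ : G.PureMemoryless) (s : S) :
    G.Admissible s (σ.law s) := by
  refine ⟨fun h t ht => ?_, fun h => by rw [law, dif_neg h]⟩
  rw [law, dif_pos h] at ht
  have : t = σ.move ⟨s, h⟩ := by
    by_contra hne
    simp [PMF.pure_apply, hne] at ht
  exact this ▸ σ.available ⟨s, h⟩

theorem admissible_stepDist (G : MDP S) (π : G.Strategy) (k : ℕ) (h : Finset.Iic k → S) :
    G.Admissible (h ⟨k, Finset.mem_Iic.2 le_rfl⟩) (G.stepDist π k h) := by
  refine ⟨fun hs t ht => ?_, fun hs => by rw [stepDist, dif_neg hs]⟩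
  rw [stepDist, dif_pos hs] at ht
  exact π.available _ _ t ht

theorem stepDist_roundStrategy (G : MDP S) (n l : ℕ) (σ τ : G.PureMemoryless) (k : ℕ)
    (h : Finset.Iic k → S) :
    G.stepDist (roundStrategy n l σ τ) k h =
      (if k % (n + l) < n then σ else τ).law (h ⟨k, Finset.mem_Iic.2 le_rfl⟩) := by
  unfold stepDist PureMemoryless.law roundStrategy
  simp only [List.length_ofFn]
  split_ifs <;> rfl

/-- `m` marks an edge in every state: player 1 takes it surely, and chance takes it with probability
at least `α`. Thus both kinds of states are treated alike. -/
theorem exists_edge_lower_bound (G : MDP S) (m : S → S) (hm : ∀ s, G.E s (m s)) :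
    ∃ σ : G.PureMemoryless, ∀ (α : ℝ), α ≤ 1 →
      (∀ (s : {s : S // s ∉ G.player}) (t : S), G.E s t → α ≤ (G.δ s t).toReal) →
      ∀ s, α ≤ (σ.law s (m s)).toReal := by
  refine ⟨⟨fun s => m s, fun s => hm s⟩, fun α h1 hα s => ?_⟩
  by_cases h : s ∈ G.player
  · simpa [PureMemoryless.law, h] using h1
  · simpa [PureMemoryless.law, h] using hα ⟨s, h⟩ _ (hm s)

variable [Fintype S]

open Classical in
/-- The best mean of `f` at the next state that player 1 can achieve. -/
noncomputable def best (G : MDP S) (f : S → ℝ) (s : S) : ℝ :=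
  if h : s ∈ G.player then ⨆ t : {t : S // G.E s t}, f t else mean (G.δ ⟨s, h⟩) f

theorem mean_le_best {G : MDP S} {s : S} {μ : PMF S} (hμ : G.Admissible s μ) (f : S → ℝ) :
    mean μ f ≤ G.best f s := by
  by_cases h : s ∈ G.player
  · rw [best, dif_pos h, ← mean_const μ (⨆ t : {t : S // G.E s t}, f t)]
    refine Finset.sum_le_sum fun t _ => ?_
    rcases eq_or_ne (μ t) 0 with h0 | h0
    · simp [h0]
    · exact mul_le_mul_of_nonneg_left
        (le_ciSup (f := fun t : {t : S // G.E s t} => f t) (Set.finite_range _).bddAbove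
          ⟨t, hμ.1 h t (pos_iff_ne_zero.2 h0)⟩) ENNReal.toReal_nonneg
  · rw [best, dif_neg h, hμ.2 h]

theorem exists_mean_law_eq_best (G : MDP S) (f : S → ℝ) :
    ∃ τ : G.PureMemoryless, ∀ s, mean (τ.law s) f = G.best f s := by
  classical
  have key : ∀ s : S, ∃ t : {t : S // G.E s t}, f t = ⨆ t : {t : S // G.E s t}, f t := by
    intro s
    obtain ⟨t, ht⟩ := G.exists_edge s
    have : Nonempty {t : S // G.E s t} := ⟨⟨t, ht⟩⟩
    exact exists_eq_ciSup_of_finite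
  choose m hm using key
  refine ⟨⟨fun s => m s, fun s => (m s).2⟩, fun s => ?_⟩
  by_cases h : s ∈ G.player
  · rw [PureMemoryless.law, best, dif_pos h, dif_pos h, mean_pure]
    exact hm s
  · rw [PureMemoryless.law, best, dif_neg h, dif_neg h]

/-- A maximizer for `f` is a candidate for `g`. This makes `best` nonexpansive in the sup norm, so
the discounted operator is a contraction. -/
theorem best_le_best_add (G : MDP S) {f g : S → ℝ} {c : ℝ} (h : ∀ t, f t ≤ g t + c) (s : S) :
    G.best f s ≤ G.best g s + c := by
  obtain ⟨τ, hτ⟩ := G.exists_mean_law_eq_best f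
  rw [← hτ s]
  refine (mean_mono h).trans ?_
  rw [mean_add, mean_const]
  gcongr
  exact mean_le_best (τ.admissible_law s) g

theorem best_add_const (G : MDP S) (f : S → ℝ) (c : ℝ) (s : S) :
    G.best (fun t => f t + c) s = G.best f s + c := by
  refine le_antisymm (G.best_le_best_add (fun _ => le_rfl) s) ?_
  have := G.best_le_best_add (f := f) (g := fun t => f t + c) (c := -c) (fun t => by simp) s
  linarith

theorem best_le (G : MDP S) {f : S → ℝ} {c : ℝ} (h : ∀ t, f t ≤ c) (s : S) : G.best f s ≤ c := by
  obtain ⟨τ, hτ⟩ := G.exists_mean_law_eq_best f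
  exact hτ s ▸ mean_le h

theorem le_best (G : MDP S) {f : S → ℝ} {c : ℝ} (h : ∀ t, c ≤ f t) (s : S) : c ≤ G.best f s := by
  obtain ⟨τ, hτ⟩ := G.exists_mean_law_eq_best f
  exact hτ s ▸ le_mean h

/-- A positive lower bound for the transition probabilities. -/
theorem exists_lower_bound (G : MDP S) : ∃ α : ℝ, 0 < α ∧ α ≤ 1 ∧
    ∀ (s : {s : S // s ∉ G.player}) (t : S), G.E s t → α ≤ (G.δ s t).toReal := by
  classical
  have hpos : ∀ (s : {s : S // s ∉ G.player}) (t : S), G.E s t → 0 < (G.δ s t).toReal :=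
    fun s t h => ENNReal.toReal_pos ((G.edge_iff s t).1 h).ne' ((G.δ s).apply_ne_top t)
  let A : Finset ℝ := insert 1 ((Finset.univ.filter
    fun x : {s : S // s ∉ G.player} × S => G.E x.1 x.2).image fun x => (G.δ x.1 x.2).toReal)
  have hA : A.Nonempty := ⟨1, Finset.mem_insert_self _ _⟩
  refine ⟨A.min' hA, ?_, A.min'_le _ (Finset.mem_insert_self _ _), fun s t h => ?_⟩
  · rw [Finset.lt_min'_iff]
    intro y hy
    rcases Finset.mem_insert.1 hy with rfl | hy
    · exact one_pos
    · obtain ⟨x, hx, rfl⟩ := Finset.mem_image.1 hy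
      exact hpos x.1 x.2 (Finset.mem_filter.1 hx).2
  · exact A.min'_le _ (Finset.mem_insert_of_mem
      (Finset.mem_image.2 ⟨(s, t), Finset.mem_filter.2 ⟨Finset.mem_univ _, h⟩, rfl⟩))

theorem exists_discounted_value (G : MDP S) (r : S → ℝ) {c : ℝ} (h0 : 0 ≤ c) (h1 : c < 1) :
    ∃ V : S → ℝ, ∀ s, V s = r s + c * G.best V s := by
  let T : (S → ℝ) → S → ℝ := fun V s => r s + c * G.best V s
  have hT : ContractingWith ⟨c, h0⟩ T := by
    refine ⟨by exact_mod_cast h1, LipschitzWith.of_dist_le_mul fun f g => ?_⟩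
    have key : ∀ (f g : S → ℝ) (s : S), G.best f s - G.best g s ≤ dist f g := by
      intro f g s
      have := G.best_le_best_add (f := f) (g := g) (c := dist f g) (fun t => by
        have h2 := (le_abs_self (f t - g t)).trans ((Real.dist_eq _ _).symm.trans_le
          (dist_le_pi_dist f g t))
        linarith) s
      linarith
    refine (dist_pi_le_iff (by positivity)).2 fun s => ?_
    rw [Real.dist_eq, add_sub_add_left_eq_sub, ← mul_sub, abs_mul, abs_of_nonneg h0]
    refine mul_le_mul_of_nonneg_left (abs_le.2 ⟨?_, key f g s⟩) h0
    have := key g f s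
    rw [dist_comm] at this
    linarith
  exact ⟨hT.fixedPoint, fun s => (congrFun hT.fixedPoint_isFixedPt s).symm⟩

end Laws

/-! ### Graph distance to a target state. -/

section Distance

variable {S : Type*} [Fintype S]

/-- In a strongly connected graph, a distance to `x` that is smaller than the number of vertices. -/
theorem exists_distance {E : S → S → Prop} (hE : ∀ s t, Relation.TransGen E s t) (x : S) :
    ∃ d : S → ℕ, (∀ s, d s < Fintype.card S) ∧ ∀ s, s ≠ x → ∃ t, E s t ∧ d t + 1 = d s := by
  classical
  -- `A k s`: some walk of exactly `k` edges leads from `s` to `x`.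
  obtain ⟨A, hzero, hsucc⟩ : ∃ A : ℕ → S → Prop, (∀ s, A 0 s ↔ s = x) ∧
      ∀ k s, A (k + 1) s ↔ ∃ t, A k t ∧ E s t :=
    ⟨fun k => Nat.rec (· = x) (fun _ B s => ∃ t, B t ∧ E s t) k, fun _ => Iff.rfl,
      fun _ _ => Iff.rfl⟩
  have hex : ∀ s : S, ∃ k : ℕ, A k s := by
    intro s
    induction hE s x using Relation.TransGen.head_induction_on with
    | single h => exact ⟨1, (hsucc _ _).2 ⟨x, (hzero x).2 rfl, h⟩⟩
    | head h _ ih =>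
      obtain ⟨k, hk⟩ := ih
      exact ⟨k + 1, (hsucc _ _).2 ⟨_, hk, h⟩⟩
  have hpred : ∀ (s : S) (k : ℕ), Nat.find (hex s) = k + 1 → ∃ t, E s t ∧ Nat.find (hex t) = k := by
    intro s k hk
    obtain ⟨t, ht, hst⟩ := (hsucc k s).1 (hk ▸ Nat.find_spec (hex s))
    refine ⟨t, hst, le_antisymm (Nat.find_min' _ ht) ?_⟩
    have := Nat.find_min' (hex s) (m := Nat.find (hex t) + 1)
      ((hsucc _ s).2 ⟨t, Nat.find_spec (hex t), hst⟩)
    omega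
  refine ⟨fun s => Nat.find (hex s), fun s => ?_, fun s hs => ?_⟩
  -- The distances attained form an initial segment of ℕ, so d s + 1 distinct values need as many
  -- vertices.
  · have hall : ∀ (j : ℕ) (s : S), Nat.find (hex s) = j → ∀ i ≤ j, ∃ u, Nat.find (hex u) = i := by
      intro j
      induction j with
      | zero => exact fun s hs i hi => ⟨s, by omega⟩
      | succ j ih =>
        intro s hs i hi
        rcases hi.eq_or_lt with rfl | hi
        · exact ⟨s, hs⟩
        · obtain ⟨t, -, ht⟩ := hpred s j hs
          exact ih t ht i (by omega)
    have hsub : Finset.range (Nat.find (hex s) + 1) ⊆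
        Finset.univ.image fun s => Nat.find (hex s) := by
      intro i hi
      obtain ⟨u, hu⟩ := hall _ s rfl i (by simpa [Nat.lt_succ_iff] using Finset.mem_range.1 hi)
      exact Finset.mem_image.2 ⟨u, Finset.mem_univ _, hu⟩
    have := (Finset.card_le_card hsub).trans Finset.card_image_le
    rwa [Finset.card_range, Finset.card_univ] at this
  · have h0 : Nat.find (hex s) ≠ 0 := fun h0 => by
      have := Nat.find_spec (hex s)
      rw [h0] at this
      exact hs ((hzero s).1 this)
    obtain ⟨k, hk⟩ := Nat.exists_eq_succ_of_ne_zero h0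
    obtain ⟨t, hst, ht⟩ := hpred s k hk
    exact ⟨t, hst, (congrArg (· + 1) ht).trans hk.symm⟩

end Distance

/-! ### The average-reward optimality equation by vanishing discount. -/

section OptimalityEquation

variable {S : Type*} [Fintype S]

/-- In a strongly connected MDP, the span of the discounted value is bounded uniformly in the
discount factor. -/
theorem exists_span_bound (G : MDP S) (hE : ∀ s t, Relation.TransGen G.E s t) (r : S → ℝ) :
    ∃ C : ℝ, 0 ≤ C ∧ ∀ (c : ℝ), 0 ≤ c → c < 1 → ∀ V : S → ℝ,
      (∀ s, V s = r s + c * G.best V s) → ∀ s t, V s - V t ≤ C := by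
  have : Nonempty S := ⟨G.init⟩
  obtain ⟨α, hα0, hα1, hα⟩ := G.exists_lower_bound
  obtain ⟨R, hR0, hR⟩ : ∃ R : ℝ, 0 ≤ R ∧ ∀ s, |r s| ≤ R :=
    ⟨∑ s, |r s|, Finset.sum_nonneg fun _ _ => abs_nonneg _, fun s =>
      Finset.single_le_sum (f := fun s => |r s|) (fun _ _ => abs_nonneg _) (Finset.mem_univ s)⟩
  set n := Fintype.card S
  -- On a path from a minimizer `y` to a maximizer `x`, each of the at most `n` edges costs a factor
  -- `α` and a summand 2R.
  refine ⟨2 * R * n / α ^ n, by positivity, fun c hc0 hc1 V hV s t => ?_⟩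
  obtain ⟨x, hx⟩ := Finite.exists_max V
  obtain ⟨y, hy⟩ := Finite.exists_min V
  have hxR : (1 - c) * V x ≤ R := by
    have h1 := mul_le_mul_of_nonneg_left (G.best_le hx x) hc0
    have h2 := (abs_le.1 (hR x)).2
    have h3 := hV x
    linarith
  obtain ⟨d, hdn, hd⟩ := exists_distance hE x
  -- One R bounds the reward; the other bounds the effect of replacing the discount factor `c` by 1,
  -- thanks to `hxR`.
  have hstep : ∀ s t, G.E s t → α * (V t - V y) - 2 * R ≤ V s - V y := by
    intro s t hst
    classical
    have hm : ∀ u, G.E u (if u = s then t else (G.exists_edge u).choose) := by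
      intro u
      split_ifs with h
      · exact h ▸ hst
      · exact (G.exists_edge u).choose_spec
    obtain ⟨σ, hσ⟩ := G.exists_edge_lower_bound _ hm
    have h1 := hσ α hα1 hα s
    rw [if_pos rfl] at h1
    have h2 := (add_mul_sub_le_mean hy t h1).trans (mean_le_best (σ.admissible_law s) V)
    have h3 := mul_le_mul_of_nonneg_left h2 hc0
    have h4 : V y + α * (V t - V y) ≤ V x := by nlinarith [hx t, hx y, hy t]
    have h5 := mul_le_mul_of_nonneg_left h4 (sub_nonneg.2 hc1.le)
    have h6 := (abs_le.1 (hR s)).1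
    have h7 := hV s
    linarith
  have hind : ∀ k s, d s = k → α ^ k * (V x - V y) - 2 * R * k ≤ V s - V y := by
    intro k
    induction k with
    | zero =>
      intro s hs
      have hsx : s = x := by
        by_contra h
        obtain ⟨t, -, ht⟩ := hd s h
        omega
      simp [hsx]
    | succ k ih =>
      intro s hs
      -- The properties of `d` do not include d x = 0, so `x` must be treated here too.
      by_cases hsx : s = x
      · subst hsx
        have h1 : α ^ (k + 1) * (V s - V y) ≤ V s - V y :=
          mul_le_of_le_one_left (sub_nonneg.2 (hy s)) (pow_le_one₀ hα0.le hα1)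
        have h2 : 0 ≤ 2 * R * ((k + 1 : ℕ) : ℝ) := by positivity
        linarith
      · obtain ⟨t, hst, ht⟩ := hd s hsx
        have h1 := mul_le_mul_of_nonneg_left (ih t (by omega)) hα0.le
        have h2 := hstep s t hst
        have h3 : α * (2 * R * k) ≤ 2 * R * k := mul_le_of_le_one_left (by positivity) hα1
        push_cast
        rw [pow_succ]
        linarith
  have hfin := hind (d y) y rfl
  have hdy : d y ≤ n := (hdn y).le
  have h1 : α ^ n * (V x - V y) ≤ α ^ d y * (V x - V y) :=
    mul_le_mul_of_nonneg_right (pow_le_pow_of_le_one hα0.le hα1 hdy) (sub_nonneg.2 (hy x))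
  have h2 : 2 * R * (d y : ℝ) ≤ 2 * R * n := by gcongr
  have h3 : V x - V y ≤ 2 * R * n / α ^ n := by
    rw [le_div_iff₀ (by positivity)]
    linarith
  linarith [hx s, hy t]

/-- The optimality equation of the long-run average, up to an arbitrarily small error. -/
theorem exists_approx_optimality_equation (G : MDP S) (hE : ∀ s t, Relation.TransGen G.E s t)
    (r : S → ℝ) {ε : ℝ} (hε : 0 < ε) :
    ∃ (v : ℝ) (h : S → ℝ), ∀ s, |r s + G.best h s - h s - v| ≤ ε := by
  have : Nonempty S := ⟨G.init⟩
  obtain ⟨C, hC0, hC⟩ := G.exists_span_bound hE r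
  -- `q` is one minus the discount factor. The error in the equation will be exactly q times a
  -- quantity in [0, C].
  set q := ε / (C + ε)
  have hq0 : 0 < q := by positivity
  have hq1 : q ≤ 1 := (div_le_one (by positivity)).2 (by linarith)
  have hqC : q * C ≤ ε := by
    rw [div_mul_eq_mul_div, div_le_iff₀ (by positivity)]
    nlinarith
  obtain ⟨V, hV⟩ := G.exists_discounted_value r (c := 1 - q) (by linarith) (by linarith)
  have hspan := hC (1 - q) (by linarith) (by linarith) V hV
  obtain ⟨y, hy⟩ := Finite.exists_min V
  refine ⟨q * V y, fun s => V s - V y, fun s => ?_⟩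
  have h1 : G.best V s = G.best (fun t => V t - V y) s + V y := by
    rw [← best_add_const]
    simp
  have h2 : 0 ≤ G.best (fun t => V t - V y) s := G.le_best (fun t => sub_nonneg.2 (hy t)) s
  have h3 : G.best (fun t => V t - V y) s ≤ C := G.best_le (fun t => hspan t y) s
  have h4 : r s + G.best (fun t => V t - V y) s - (V s - V y) - q * V y =
      q * G.best (fun t => V t - V y) s := by
    have := hV s
    rw [h1] at this
    linear_combination -this
  rw [h4, abs_of_nonneg (by positivity)]
  exact (mul_le_mul_of_nonneg_left h3 hq0.le).trans hqC

end OptimalityEquation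

end MDP

/-! ### A strong law for bounded orthogonal variables. -/

section LawOfLargeNumbers

variable {Ω : Type*} [MeasurableSpace Ω] {μ : Measure Ω}

theorem integrable_of_abs_le [IsFiniteMeasure μ] {f : Ω → ℝ} (hf : Measurable f) {C : ℝ}
    (h : ∀ ω, |f ω| ≤ C) : Integrable f μ :=
  Integrable.of_bound hf.aestronglyMeasurable C (ae_of_all _ h)

theorem integral_sum_sq_le [IsProbabilityMeasure μ] {X : ℕ → Ω → ℝ} (hX : ∀ i, Measurable (X i))
    {C : ℝ} (hC : ∀ i ω, |X i ω| ≤ C) (horth : ∀ i j, i < j → ∫ ω, X i ω * X j ω ∂μ = 0) (N : ℕ) :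
    ∫ ω, (∑ i ∈ Finset.range N, X i ω) ^ 2 ∂μ ≤ N * C ^ 2 := by
  have hsum : ∀ N, Measurable fun ω => ∑ i ∈ Finset.range N, X i ω := fun N =>
    Finset.measurable_fun_sum _ fun i _ => hX i
  have hbd : ∀ N ω, |∑ i ∈ Finset.range N, X i ω| ≤ N * C := fun N ω => by
    refine (Finset.abs_sum_le_sum_abs _ _).trans ((Finset.sum_le_sum fun i _ => hC i ω).trans ?_)
    simp
  induction N with
  | zero => simp
  | succ N ih =>
    have h0 : ∀ ω, 0 ≤ C := fun ω => (abs_nonneg _).trans (hC 0 ω)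
    have i1 : Integrable (fun ω => (∑ i ∈ Finset.range N, X i ω) ^ 2) μ :=
      integrable_of_abs_le ((hsum N).pow_const 2) (C := (N * C) ^ 2) fun ω => by
        rw [abs_pow]
        exact pow_le_pow_left₀ (abs_nonneg _) (hbd N ω) 2
    have i2 : ∀ i, Integrable (fun ω => X i ω * X N ω) μ := fun i =>
      integrable_of_abs_le ((hX i).mul (hX N)) (C := C * C) fun ω => by
        rw [abs_mul]
        exact mul_le_mul (hC i ω) (hC N ω) (abs_nonneg _) (h0 ω)
    have i3 : Integrable (fun ω => ∑ i ∈ Finset.range N, X i ω * X N ω) μ :=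
      integrable_finsetSum _ fun i _ => i2 i
    have hcross : ∫ ω, ∑ i ∈ Finset.range N, X i ω * X N ω ∂μ = 0 := by
      rw [integral_finsetSum _ fun i _ => i2 i]
      exact Finset.sum_eq_zero fun i hi => horth i N (Finset.mem_range.1 hi)
    have hlast : ∫ ω, X N ω * X N ω ∂μ ≤ C ^ 2 := by
      have : ∫ ω, X N ω * X N ω ∂μ ≤ ∫ _, C ^ 2 ∂μ := by
        refine integral_mono (i2 N) (integrable_const _) fun ω => ?_
        have := pow_le_pow_left₀ (abs_nonneg _) (hC N ω) 2
        rwa [sq_abs, sq] at this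
      simpa using this
    have hexp : ∀ ω, (∑ i ∈ Finset.range (N + 1), X i ω) ^ 2 =
        (∑ i ∈ Finset.range N, X i ω) ^ 2 + 2 * (∑ i ∈ Finset.range N, X i ω * X N ω) +
          X N ω * X N ω := fun ω => by
      rw [Finset.sum_range_succ, ← Finset.sum_mul]
      ring
    have e1 : ∫ ω, (∑ i ∈ Finset.range N, X i ω) ^ 2 +
        2 * (∑ i ∈ Finset.range N, X i ω * X N ω) ∂μ =
        ∫ ω, (∑ i ∈ Finset.range N, X i ω) ^ 2 ∂μ := by
      rw [integral_add i1 (i3.const_mul 2), integral_const_mul, hcross, mul_zero, add_zero]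
    have e2 := integral_add (i1.add (i3.const_mul 2)) (i2 N)
    simp only [Pi.add_apply] at e2
    simp_rw [hexp]
    rw [e2, e1]
    push_cast
    linarith

/-- A strong law of large numbers for bounded orthogonal random variables. -/
theorem ae_tendsto_average_of_orthogonal [IsProbabilityMeasure μ] {X : ℕ → Ω → ℝ}
    (hX : ∀ i, Measurable (X i)) {C : ℝ} (hC : ∀ i ω, |X i ω| ≤ C)
    (horth : ∀ i j, i < j → ∫ ω, X i ω * X j ω ∂μ = 0) :
    ∀ᵐ ω ∂μ, Tendsto (fun N : ℕ => (∑ i ∈ Finset.range N, X i ω) / N) atTop (nhds 0) := by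
  have hsum : ∀ N, Measurable fun ω => ∑ i ∈ Finset.range N, X i ω := fun N =>
    Finset.measurable_fun_sum _ fun i _ => hX i
  have hbd : ∀ N ω, |∑ i ∈ Finset.range N, X i ω| ≤ N * C := fun N ω => by
    refine (Finset.abs_sum_le_sum_abs _ _).trans ((Finset.sum_le_sum fun i _ => hC i ω).trans ?_)
    simp
  -- Along the squares the second moments of the averages are summable, which forces almost sure
  -- convergence.
  let c : ℕ → ℕ := fun k => (k + 1) ^ 2
  let Y : ℕ → Ω → ℝ := fun k ω => ((∑ i ∈ Finset.range (c k), X i ω) / c k) ^ 2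
  have hY : ∀ k, Measurable (Y k) := fun k => ((hsum (c k)).div_const _).pow_const 2
  have hYint : ∀ k, ∫⁻ ω, ENNReal.ofReal (Y k ω) ∂μ ≤
      ENNReal.ofReal (C ^ 2 * (1 / ((k + 1 : ℕ) : ℝ) ^ 2)) := by
    intro k
    have hint : Integrable (Y k) μ := integrable_of_abs_le (hY k) (C := C ^ 2) fun ω => by
      have hc : (0 : ℝ) < c k := by simp only [c]; positivity
      rw [abs_pow]
      refine pow_le_pow_left₀ (abs_nonneg _) ?_ 2
      rw [abs_div, abs_of_pos hc, div_le_iff₀ hc, mul_comm]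
      exact hbd _ ω
    rw [← ofReal_integral_eq_lintegral_ofReal hint (ae_of_all _ fun ω => sq_nonneg _)]
    refine ENNReal.ofReal_le_ofReal ?_
    have h1 := integral_sum_sq_le hX hC horth (c k)
    simp only [Y, div_pow]
    rw [integral_div, div_le_iff₀ (by simp only [c]; positivity)]
    refine h1.trans_eq ?_
    simp only [c]
    push_cast
    field_simp
  have hsummable : Summable fun k : ℕ => C ^ 2 * (1 / ((k + 1 : ℕ) : ℝ) ^ 2) :=
    ((summable_nat_add_iff 1 (f := fun k : ℕ => 1 / (k : ℝ) ^ 2)).2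
      (Real.summable_one_div_nat_pow.2 one_lt_two)).mul_left _
  have hfin : ∫⁻ ω, ∑' k, ENNReal.ofReal (Y k ω) ∂μ ≠ ⊤ := by
    rw [lintegral_tsum fun k => (hY k).ennreal_ofReal.aemeasurable]
    exact ((ENNReal.tsum_le_tsum hYint).trans_lt hsummable.tsum_ofReal_lt_top).ne
  filter_upwards [ae_lt_top (Measurable.tsum fun k => (hY k).ennreal_ofReal) hfin] with ω hω
  have h0 := ENNReal.tendsto_atTop_zero_of_tsum_ne_top hω.ne
  have h1 : Tendsto (fun k => Y k ω) atTop (nhds 0) := by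
    have := (ENNReal.tendsto_toReal ENNReal.zero_ne_top).comp h0
    refine this.congr fun k => ?_
    exact ENNReal.toReal_ofReal (sq_nonneg _)
  have h2 : Tendsto (fun k => (∑ i ∈ Finset.range (c k), X i ω) / c k) atTop (nhds 0) := by
    have h3 := h1.sqrt
    rw [Real.sqrt_zero] at h3
    refine (tendsto_zero_iff_abs_tendsto_zero _).2 (h3.congr fun k => ?_)
    exact Real.sqrt_sq_eq_abs _
  -- Adding N * C makes the partial sums monotone. Since ratios of consecutive squares tend to 1,
  -- convergence along the squares then extends to all N.
  let u : ℕ → ℝ := fun N => ∑ i ∈ Finset.range N, X i ω + N * C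
  have hu : Monotone u := monotone_nat_of_le_succ fun N => by
    have := (abs_le.1 (hC N ω)).1
    simp only [u, Finset.sum_range_succ]
    push_cast
    linarith
  have hlim : Tendsto (fun N => u N / N) atTop (nhds C) := by
    refine tendsto_div_of_monotone_of_exists_subseq_tendsto_div u C hu fun a ha => ⟨c, ?_, ?_, ?_⟩
    · filter_upwards [eventually_ge_atTop ⌈3 / (a - 1)⌉₊] with k hk
      have h4 : 3 / (a - 1) ≤ k := (Nat.le_ceil _).trans (by exact_mod_cast hk)
      rw [div_le_iff₀ (by linarith)] at h4
      have h5 : (0 : ℝ) ≤ k := Nat.cast_nonneg k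
      simp only [c]
      push_cast
      nlinarith
    · exact tendsto_atTop_mono (fun k => by simp only [c, id]; nlinarith) tendsto_id
    · have h6 := h2.add_const C
      rw [zero_add] at h6
      refine h6.congr fun k => ?_
      have hc : (0 : ℝ) < c k := by simp only [c]; positivity
      simp only [u]
      field_simp
  have h7 := hlim.sub_const C
  rw [sub_self] at h7
  refine h7.congr' ?_
  filter_upwards [eventually_gt_atTop 0] with N hN
  have : (0 : ℝ) < N := by exact_mod_cast hN
  simp only [u]
  field_simp
  ring

end LawOfLargeNumbers

/-! ### Deviations from conditional means along a play. -/

namespace MDP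

variable {S : Type*} [Fintype S] [MeasurableSpace S] [DiscreteMeasurableSpace S]

instance (G : MDP S) (π : G.Strategy) (s : S) : IsProbabilityMeasure (G.playMeasure π s) :=
  inferInstanceAs (IsProbabilityMeasure (Kernel.traj (X := fun _ => S) (G.stepKernel π) 0 _))

/-- The deviation of `g` at the state number `k + 1` from its conditional mean. -/
noncomputable def deviation (G : MDP S) (π : G.Strategy) (g : S → ℝ) (k : ℕ) (ω : ℕ → S) : ℝ :=
  g (ω (k + 1)) - mean (G.stepDist π k (Preorder.frestrictLe (π := fun _ => S) k ω)) g

theorem measurable_deviation (G : MDP S) (π : G.Strategy) (g : S → ℝ) (k : ℕ) :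
    Measurable (G.deviation π g k) := by
  refine Measurable.sub ((measurable_of_countable g).comp (measurable_pi_apply _)) ?_
  exact (measurable_of_countable fun h => mean (G.stepDist π k h) g).comp
    (Preorder.measurable_frestrictLe (X := fun _ => S) k)

omit [MeasurableSpace S] [DiscreteMeasurableSpace S] in
theorem abs_deviation_le (G : MDP S) (π : G.Strategy) {g : S → ℝ} {C : ℝ} (hg : ∀ s, |g s| ≤ C)
    (k : ℕ) (ω : ℕ → S) : |G.deviation π g k ω| ≤ 2 * C := by
  refine (abs_sub _ _).trans ?_
  linarith [hg (ω (k + 1)), abs_mean_le hg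
    (μ := G.stepDist π k (Preorder.frestrictLe (π := fun _ => S) k ω))]

/-- The joint law of history and next state is a composition product with the step kernel;
integrating over the next state first gives zero for each history. -/
theorem integral_mul_deviation (G : MDP S) (π : G.Strategy) (s : S) (g : S → ℝ) (k : ℕ)
    (F : (Finset.Iic k → S) → ℝ) :
    ∫ ω, F (Preorder.frestrictLe (π := fun _ => S) k ω) * G.deviation π g k ω
      ∂G.playMeasure π s = 0 := by
  let Φ : (Finset.Iic k → S) × S → ℝ := fun x => F x.1 * (g x.2 - mean (G.stepDist π k x.1) g)
  have hΦ : Measurable Φ := measurable_of_countable Φ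
  have hmap := Kernel.partialTraj_compProd_eq_map_traj (X := fun _ => S) (κ := G.stepKernel π)
    (Nat.zero_le k) (x₀ := fun _ => s)
  have h1 : ∫ ω, F (Preorder.frestrictLe (π := fun _ => S) k ω) * G.deviation π g k ω
      ∂G.playMeasure π s = ∫ x, Φ x ∂(G.playMeasure π s).map
        (fun ω => (Preorder.frestrictLe (π := fun _ => S) k ω, ω (k + 1))) := by
    rw [integral_map (by fun_prop) hΦ.aestronglyMeasurable]
    rfl
  rw [h1, playMeasure, ← hmap, Measure.integral_compProd]
  · refine integral_eq_zero_of_ae (ae_of_all _ fun x => ?_)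
    change ∫ y, Φ (x, y) ∂(G.stepDist π k x).toMeasure = 0
    rw [PMF.integral_eq_sum]
    have h2 : ∀ y, ((G.stepDist π k x) y).toReal • Φ (x, y) =
        F x * (((G.stepDist π k x) y).toReal * g y) -
          F x * mean (G.stepDist π k x) g * ((G.stepDist π k x) y).toReal := fun y => by
      simp only [Φ, smul_eq_mul]
      ring
    simp_rw [h2]
    rw [Finset.sum_sub_distrib, ← Finset.mul_sum, ← Finset.mul_sum, sum_toReal_pmf]
    simp only [mean]
    ring
  · exact Integrable.of_finite

/-- The deviations of a bounded process from its conditional means average out almost surely. -/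
theorem ae_tendsto_average_deviation (G : MDP S) (π : G.Strategy) (s : S) {g : ℕ → S → ℝ} {C : ℝ}
    (hg : ∀ i t, |g i t| ≤ C) :
    ∀ᵐ ω ∂G.playMeasure π s, Tendsto
      (fun N : ℕ => (∑ i ∈ Finset.range N, G.deviation π (g i) i ω) / N) atTop (nhds 0) := by
  refine ae_tendsto_average_of_orthogonal (fun i => G.measurable_deviation π (g i) i)
    (fun i ω => G.abs_deviation_le π (hg i) i ω) fun i j hij => ?_
  -- As i + 1 ≤ j, the earlier deviation is a function of the history up to `j`.
  let F : (Finset.Iic j → S) → ℝ := fun h =>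
    g i (h ⟨i + 1, Finset.mem_Iic.2 hij⟩) -
      mean (G.stepDist π i fun a => h ⟨a, Finset.mem_Iic.2 ((Finset.mem_Iic.1 a.2).trans hij.le)⟩)
        (g i)
  exact G.integral_mul_deviation π s (g j) j F

end MDP

/-! ### Bounds for the long-run average, and counting steps within rounds. -/

section LimAvg

variable {S : Type*}

theorem abs_average_le {r : S → ℝ} {R : ℝ} (hR : ∀ s, |r s| ≤ R) (ω : ℕ → S) (N : ℕ) :
    |(1 / (N : ℝ)) * ∑ i ∈ Finset.range N, r (ω i)| ≤ R := by
  have hR0 : 0 ≤ R := (abs_nonneg _).trans (hR (ω 0))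
  rcases N.eq_zero_or_pos with rfl | hN
  · simpa using hR0
  · have hN' : (0 : ℝ) < N := by exact_mod_cast hN
    rw [abs_mul, abs_of_pos (one_div_pos.2 hN'), one_div_mul_eq_div, div_le_iff₀ hN']
    refine (Finset.abs_sum_le_sum_abs _ _).trans
      ((Finset.sum_le_sum fun i _ => hR (ω i)).trans_eq ?_)
    simp [mul_comm]

theorem isBoundedUnder_ge_average {r : S → ℝ} {R : ℝ} (hR : ∀ s, |r s| ≤ R) (ω : ℕ → S) :
    IsBoundedUnder (· ≥ ·) atTop
      fun N : ℕ => (1 / (N : ℝ)) * ∑ i ∈ Finset.range N, r (ω i) :=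
  isBoundedUnder_of ⟨-R, fun N => (abs_le.1 (abs_average_le hR ω N)).1⟩

theorem isBoundedUnder_le_average {r : S → ℝ} {R : ℝ} (hR : ∀ s, |r s| ≤ R) (ω : ℕ → S) :
    IsBoundedUnder (· ≤ ·) atTop
      fun N : ℕ => (1 / (N : ℝ)) * ∑ i ∈ Finset.range N, r (ω i) :=
  isBoundedUnder_of ⟨R, fun N => (abs_le.1 (abs_average_le hR ω N)).2⟩

theorem limAvg_le_of_tendsto {r : S → ℝ} {R : ℝ} (hR : ∀ s, |r s| ≤ R) {ω : ℕ → S} {b : ℕ → ℝ}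
    {β : ℝ} (hb : Tendsto b atTop (nhds β))
    (h : ∀ᶠ N : ℕ in atTop, (1 / (N : ℝ)) * ∑ i ∈ Finset.range N, r (ω i) ≤ b N) :
    limAvg r ω ≤ β :=
  (liminf_le_liminf h (isBoundedUnder_ge_average hR ω)
    hb.isBoundedUnder_le.isCoboundedUnder_ge).trans_eq hb.liminf_eq

theorem le_limAvg_of_tendsto {r : S → ℝ} {R : ℝ} (hR : ∀ s, |r s| ≤ R) {ω : ℕ → S} {b : ℕ → ℝ}
    {β : ℝ} (hb : Tendsto b atTop (nhds β))
    (h : ∀ᶠ N : ℕ in atTop, b N ≤ (1 / (N : ℝ)) * ∑ i ∈ Finset.range N, r (ω i)) :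
    β ≤ limAvg r ω :=
  hb.liminf_eq.symm.trans_le (liminf_le_liminf h hb.isBoundedUnder_ge
    (isBoundedUnder_le_average hR ω).isCoboundedUnder_ge)

theorem abs_limAvg_le {r : S → ℝ} {R : ℝ} (hR : ∀ s, |r s| ≤ R) (ω : ℕ → S) :
    |limAvg r ω| ≤ R :=
  abs_le.2 ⟨le_limAvg_of_tendsto hR tendsto_const_nhds
      (Eventually.of_forall fun N => (abs_le.1 (abs_average_le hR ω N)).1),
    limAvg_le_of_tendsto hR tendsto_const_nhds
      (Eventually.of_forall fun N => (abs_le.1 (abs_average_le hR ω N)).2)⟩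

theorem measurable_limAvg [Countable S] [MeasurableSpace S] [DiscreteMeasurableSpace S]
    (r : S → ℝ) : Measurable (limAvg r) :=
  Measurable.liminf fun _ => (Finset.measurable_fun_sum _ fun i _ =>
    (measurable_of_countable r).comp (measurable_pi_apply i)).const_mul _

theorem exists_abs_le [Finite S] (f : S → ℝ) : ∃ C : ℝ, 0 ≤ C ∧ ∀ s, |f s| ≤ C := by
  obtain ⟨C, hC⟩ := (Set.finite_range fun s => |f s|).bddAbove
  exact ⟨max C 0, le_max_right _ _, fun s => (hC (Set.mem_range_self s)).trans (le_max_left _ _)⟩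

end LimAvg

theorem minPriority_eq_of_mem {S : Type*} (p : S → ℕ) {U : Set S} {x : S} (hx : x ∈ U)
    (hmin : p x = minPriority p Set.univ) : minPriority p U = minPriority p Set.univ := by
  refine le_antisymm ((Nat.sInf_le (Set.mem_image_of_mem p hx)).trans_eq hmin) ?_
  obtain ⟨y, -, hy⟩ := Nat.sInf_mem (s := p '' U) ⟨p x, x, hx, rfl⟩
  exact (Nat.sInf_le (Set.mem_image_of_mem p (Set.mem_univ y))).trans_eq hy

theorem sum_range_ite_mod_lt_le {L n : ℕ} (hL : 0 < L) (hn : n ≤ L) (N : ℕ) :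
    ∑ i ∈ Finset.range N, (if i % L < n then 1 else 0) ≤ n * (N / L) + n := by
  -- The exact count, with the current partial round included, is what passes through the induction.
  suffices h : ∑ i ∈ Finset.range N, (if i % L < n then 1 else 0) =
      n * (N / L) + min (N % L) n by
    rw [h]
    gcongr
    exact min_le_right _ _
  induction N with
  | zero => simp
  | succ N ih =>
    rw [Finset.sum_range_succ, ih]
    have h1 := Nat.div_add_mod N L
    have h2 := Nat.mod_lt N hL
    set q := N / L
    set m := N % L
    rcases (Nat.succ_le_of_lt h2).lt_or_eq with h3 | h3
    · have h4 : N + 1 = L * q + (m + 1) := by omega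
      rw [h4, Nat.mul_add_div hL, Nat.mul_add_mod, Nat.div_eq_of_lt h3, Nat.mod_eq_of_lt h3, add_zero]
      split_ifs <;> omega
    · have h4 : N + 1 = L * (q + 1) := by
        rw [mul_add]
        omega
      rw [h4, Nat.mul_div_cancel_left _ hL, Nat.mul_mod_right, mul_add]
      split_ifs <;> omega

namespace MDP

/-! ### Round strategies as finite-state machines. -/

section FiniteMemory

variable {S : Type*}

/-- The memory is a clock modulo n + l that ignores which state is read. -/
theorem isFiniteMemory_roundStrategy (G : MDP S) {n l : ℕ} (hl : 0 < n + l)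
    (σ τ : G.PureMemoryless) : (roundStrategy n l σ τ).IsFiniteMemory := by
  classical
  let M : G.FiniteStateMachine :=
    { Q := Fin (n + l)
      finite := inferInstance
      q₀ := ⟨0, hl⟩
      upd := fun q _ => ⟨(q + 1) % (n + l), Nat.mod_lt _ hl⟩
      out := fun q s => if h : s ∈ G.player then
        (if (q : ℕ) < n then σ.move ⟨s, h⟩ else τ.move ⟨s, h⟩) else s
      available := fun q s h => by
        rw [dif_pos h]
        split_ifs
        · exact σ.available ⟨s, h⟩
        · exact τ.available ⟨s, h⟩ }
  have hfold : ∀ v : List S, ((v.foldl M.upd M.q₀ : Fin (n + l)) : ℕ) = v.length % (n + l) := by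
    intro v
    induction v using List.reverseRecOn with
    | nil => simp [M]
    | append_singleton v a ih =>
      rw [List.foldl_append, List.length_append]
      change (((v.foldl M.upd M.q₀ : Fin (n + l)) : ℕ) + 1) % (n + l) = _
      rw [ih, Nat.mod_add_mod]
      rfl
  refine ⟨M, ?_⟩
  have hdist : (roundStrategy n l σ τ).dist = M.strategy.dist := by
    funext v s
    change PMF.pure _ = PMF.pure (if h : (s : S) ∈ G.player then
      (if ((v.foldl M.upd M.q₀ : Fin (n + l)) : ℕ) < n then σ.move ⟨s, h⟩ else τ.move ⟨s, h⟩)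
      else s)
    rw [dif_pos s.2, hfold]
  cases h1 : roundStrategy n l σ τ
  cases h2 : M.strategy
  rw [h1, h2] at hdist
  cases hdist
  rfl

end FiniteMemory

/-! ### Almost sure behaviour of plays. -/

section LongRun

variable {S : Type*} [Fintype S] [MeasurableSpace S] [DiscreteMeasurableSpace S]

/-- Each reward is at most `v` plus a telescoping difference of `h` plus a deviation; the last two
average out. -/
theorem ae_limAvg_le (G : MDP S) {r h : S → ℝ} {v : ℝ} (hv : ∀ s, r s + G.best h s ≤ v + h s)
    (π : G.Strategy) (s : S) : ∀ᵐ ω ∂G.playMeasure π s, limAvg r ω ≤ v := by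
  obtain ⟨R, -, hR⟩ := exists_abs_le r
  obtain ⟨H, -, hH⟩ := exists_abs_le h
  filter_upwards [G.ae_tendsto_average_deviation π s (g := fun _ => h) fun _ => hH] with ω hω
  have hstep : ∀ i, r (ω i) ≤ v + (h (ω i) - h (ω (i + 1))) + G.deviation π h i ω := by
    intro i
    have h1 := mean_le_best
      (G.admissible_stepDist π i (Preorder.frestrictLe (π := fun _ => S) i ω)) h
    change _ ≤ G.best h (ω i) at h1
    rw [deviation]
    linarith [hv (ω i)]
  have hsum : ∀ N : ℕ, ∑ i ∈ Finset.range N, r (ω i) ≤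
      N * v + 2 * H + ∑ i ∈ Finset.range N, G.deviation π h i ω := by
    intro N
    refine (Finset.sum_le_sum fun i _ => hstep i).trans ?_
    rw [Finset.sum_add_distrib, Finset.sum_add_distrib, Finset.sum_range_sub']
    simp only [Finset.sum_const, Finset.card_range, nsmul_eq_mul]
    linarith [(abs_le.1 (hH (ω 0))).2, (abs_le.1 (hH (ω N))).1]
  have hlim : Tendsto (fun N : ℕ => v + 2 * H / N +
      (∑ i ∈ Finset.range N, G.deviation π h i ω) / N) atTop (nhds v) := by
    simpa using (tendsto_const_nhds.add (tendsto_const_div_atTop_nhds_zero_nat (2 * H))).add hω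
  refine limAvg_le_of_tendsto hR hlim ?_
  filter_upwards [eventually_gt_atTop 0] with N hN
  have hN' : (0 : ℝ) < N := by exact_mod_cast hN
  refine (mul_le_mul_of_nonneg_left (hsum N) (one_div_pos.2 hN').le).trans_eq ?_
  field_simp

/-- The reverse telescoping estimate, with loss `D` on each `σ` step; these have frequency n / (n +
l). -/
theorem ae_le_limAvg_roundStrategy (G : MDP S) {r h : S → ℝ} {v D : ℝ} (hD : 0 ≤ D) {n l : ℕ}
    (hl : 0 < n + l) {σ τ : G.PureMemoryless}
    (hτ : ∀ s, v + h s ≤ r s + mean (τ.law s) h) (hσ : ∀ s, v + h s ≤ r s + mean (σ.law s) h + D)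
    (s : S) : ∀ᵐ ω ∂G.playMeasure (roundStrategy n l σ τ) s,
      v - D * (n / (n + l : ℕ)) ≤ limAvg r ω := by
  obtain ⟨R, -, hR⟩ := exists_abs_le r
  obtain ⟨H, -, hH⟩ := exists_abs_le h
  set π := roundStrategy n l σ τ with hπ
  filter_upwards [G.ae_tendsto_average_deviation π s (g := fun _ => h) fun _ => hH] with ω hω
  have hstep : ∀ i, v + (h (ω i) - h (ω (i + 1))) + G.deviation π h i ω -
      D * ((if i % (n + l) < n then 1 else 0 : ℕ) : ℝ) ≤ r (ω i) := by
    intro i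
    rw [deviation, hπ, stepDist_roundStrategy]
    change v + _ + (_ - mean (PureMemoryless.law _ (ω i)) h) - _ ≤ _
    split_ifs
    · push_cast
      linarith [hσ (ω i)]
    · push_cast
      linarith [hτ (ω i)]
  have hsum : ∀ N : ℕ, N * v - 2 * H + ∑ i ∈ Finset.range N, G.deviation π h i ω -
      D * (n * (N / (n + l : ℕ)) + n) ≤ ∑ i ∈ Finset.range N, r (ω i) := by
    intro N
    refine le_trans ?_ (Finset.sum_le_sum fun i _ => hstep i)
    rw [Finset.sum_sub_distrib, Finset.sum_add_distrib, Finset.sum_add_distrib,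
      Finset.sum_range_sub', ← Finset.mul_sum, ← Nat.cast_sum]
    simp only [Finset.sum_const, Finset.card_range, nsmul_eq_mul]
    have h1 : ((∑ i ∈ Finset.range N, (if i % (n + l) < n then 1 else 0) : ℕ) : ℝ) ≤
        n * (N / (n + l : ℕ)) + n := by
      refine (Nat.cast_le.2 (sum_range_ite_mod_lt_le hl (Nat.le_add_right n l) N)).trans ?_
      rw [Nat.cast_add, Nat.cast_mul]
      gcongr
      exact Nat.cast_div_le
    have h2 := mul_le_mul_of_nonneg_left h1 hD
    linarith [(abs_le.1 (hH (ω 0))).1, (abs_le.1 (hH (ω N))).2]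
  have hlim : Tendsto (fun N : ℕ => v - D * (n / (n + l : ℕ)) - (2 * H + D * n) / N +
      (∑ i ∈ Finset.range N, G.deviation π h i ω) / N) atTop
        (nhds (v - D * (n / (n + l : ℕ)))) := by
    simpa only [sub_zero, add_zero] using
      (tendsto_const_nhds.sub (tendsto_const_div_atTop_nhds_zero_nat (2 * H + D * n))).add hω
  refine le_limAvg_of_tendsto hR hlim ?_
  filter_upwards [eventually_gt_atTop 0] with N hN
  have hN' : (0 : ℝ) < N := by exact_mod_cast hN
  have hL : (0 : ℝ) < (n + l : ℕ) := by exact_mod_cast hl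
  refine le_trans (le_of_eq ?_) (mul_le_mul_of_nonneg_left (hsum N) (one_div_pos.2 hN').le)
  field_simp
  ring

/-- If `σ` decreases the distance `d` to `x` with probability at least `α`, then rounds that start
with more than `d` steps of `σ` visit `x` infinitely often. -/
theorem ae_mem_infStates_roundStrategy (G : MDP S) {n l : ℕ} (hl : 0 < l) {σ τ : G.PureMemoryless}
    {x : S} {d : S → ℕ} (hdn : ∀ s, d s < n) {m : S → S} (hm : ∀ s, s ≠ x → d (m s) + 1 = d s)
    {α : ℝ} (hα0 : 0 < α) (hα1 : α ≤ 1) (hα : ∀ s, α ≤ (σ.law s (m s)).toReal) (s : S) :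
    ∀ᵐ ω ∂G.playMeasure (roundStrategy n l σ τ) s, x ∈ infStates ω := by
  classical
  set π := roundStrategy n l σ τ with hπ
  -- A lower bound for the probability of meeting `x` in the rest of the round from position `j`:
  -- all d t steps must go closer while `σ` is still played.
  let W : ℕ → S → ℝ := fun j t => if j + d t < n then α ^ d t else 0
  have hW0 : ∀ j t, 0 ≤ W j t := fun j t => by
    simp only [W]
    split_ifs <;> positivity
  have hW1 : ∀ j t, W j t ≤ 1 := fun j t => by
    simp only [W]
    split_ifs
    · exact pow_le_one₀ hα0.le hα1
    · exact zero_le_one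
  filter_upwards [G.ae_tendsto_average_deviation π s (g := fun i => W (i % (n + l) + 1)) (C := 1)
    fun i t => abs_le.2 ⟨by linarith [hW0 (i % (n + l) + 1) t], hW1 _ t⟩] with ω hω
  -- The potential can decrease in mean only at a visit to `x`.
  have hdrift : ∀ i, W (i % (n + l)) (ω i) ≤ (if ω i = x then 1 else 0) +
      mean (G.stepDist π i (Preorder.frestrictLe (π := fun _ => S) i ω))
        (W (i % (n + l) + 1)) := by
    intro i
    rw [hπ, stepDist_roundStrategy]
    change _ ≤ _ + mean (PureMemoryless.law _ (ω i)) _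
    have h0 : ∀ μ : PMF S, 0 ≤ mean μ (W (i % (n + l) + 1)) := fun μ => le_mean (hW0 _)
    by_cases hx : ω i = x
    · rw [if_pos hx]
      linarith [hW1 (i % (n + l)) (ω i),
        h0 ((if i % (n + l) < n then σ else τ).law (ω i))]
    · rw [if_neg hx, zero_add]
      by_cases hlt : i % (n + l) + d (ω i) < n
      · rw [if_pos (by omega)]
        have h1 := add_mul_sub_le_mean (hW0 (i % (n + l) + 1)) (m (ω i)) (hα (ω i))
        have h2 := hm (ω i) hx
        have h3 : W (i % (n + l) + 1) (m (ω i)) = α ^ d (m (ω i)) := if_pos (by omega)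
        rw [h3, zero_add, sub_zero, ← pow_succ', h2] at h1
        exact (if_pos hlt).trans_le h1
      · exact (if_neg hlt).trans_le (h0 _)
  -- At the end of a round the position is n + l, with potential 0; resetting it to 0 gains at least
  -- α ^ n.
  have hround : ∀ i, W (i % (n + l) + 1) (ω (i + 1)) +
      α ^ n * (if n + l ∣ i + 1 then 1 else 0) ≤ W ((i + 1) % (n + l)) (ω (i + 1)) := by
    intro i
    have h1 := Nat.mod_lt i (show 0 < n + l by omega)
    split_ifs with hdvd
    · have h2 : i % (n + l) + 1 = n + l := by
        by_contra hne
        rw [Nat.dvd_iff_mod_eq_zero, ← Nat.mod_add_mod, Nat.mod_eq_of_lt (by omega)] at hdvd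
        omega
      have h3 : W (n + l) (ω (i + 1)) = 0 := if_neg (by omega)
      have h4 : W 0 (ω (i + 1)) = α ^ d (ω (i + 1)) := if_pos (by simpa using hdn _)
      rw [h2, h3, Nat.mod_eq_zero_of_dvd hdvd, h4, zero_add, mul_one]
      exact pow_le_pow_of_le_one hα0.le hα1 (hdn _).le
    · have h2 : (i + 1) % (n + l) = i % (n + l) + 1 := by
        rw [← Nat.mod_add_mod]
        refine Nat.mod_eq_of_lt (lt_of_le_of_ne h1 fun h => hdvd ?_)
        rw [Nat.dvd_iff_mod_eq_zero, ← Nat.mod_add_mod, h, Nat.mod_self]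
      rw [h2, mul_zero, add_zero]
  -- Telescoping the potential: up to bounded and averaging terms, the visits to `x` number at least
  -- α ^ n per completed round.
  have hsum : ∀ N : ℕ, α ^ n * ((N / (n + l) : ℕ) : ℝ) - 1 +
      ∑ i ∈ Finset.range N, G.deviation π (W (i % (n + l) + 1)) i ω ≤
        ∑ i ∈ Finset.range N, if ω i = x then 1 else 0 := by
    intro N
    have h1 : ∀ i ∈ Finset.range N, (W (i % (n + l)) (ω i) - W ((i + 1) % (n + l)) (ω (i + 1))) +
        α ^ n * (if n + l ∣ i + 1 then 1 else 0) + G.deviation π (W (i % (n + l) + 1)) i ω ≤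
          if ω i = x then 1 else 0 := fun i _ => by
      rw [deviation]
      linarith [hdrift i, hround i]
    refine le_trans ?_ (Finset.sum_le_sum h1)
    rw [Finset.sum_add_distrib, Finset.sum_add_distrib, ← Finset.mul_sum,
      Finset.sum_range_sub' (fun i => W (i % (n + l)) (ω i)), ← Nat.card_multiples,
      Finset.sum_boole]
    linarith [hW0 (0 % (n + l)) (ω 0), hW1 (N % (n + l)) (ω N)]
  by_contra hfin
  simp only [infStates, Set.mem_ofPred_eq, not_forall, not_exists, not_and] at hfin
  obtain ⟨k, hk⟩ := hfin
  have hbound : ∀ N : ℕ, ∑ i ∈ Finset.range N, (if ω i = x then (1 : ℝ) else 0) ≤ k + 1 := by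
    intro N
    rw [Finset.sum_boole]
    have h1 : (Finset.range N).filter (fun i => ω i = x) ⊆ Finset.range (k + 1) := fun i hi => by
      rw [Finset.mem_range]
      by_contra hki
      exact hk i (by omega) (Finset.mem_filter.1 hi).2
    have h2 := Finset.card_le_card h1
    rw [Finset.card_range] at h2
    exact_mod_cast h2
  have hL : (0 : ℝ) < (n + l : ℕ) := by exact_mod_cast (show 0 < n + l by omega)
  have hαn : 0 < α ^ n := by positivity
  have hle : ∀ᶠ N : ℕ in atTop, α ^ n / (n + l : ℕ) +
      (∑ i ∈ Finset.range N, G.deviation π (W (i % (n + l) + 1)) i ω) / N ≤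
        (α ^ n + k + 2) / N := by
    filter_upwards [eventually_gt_atTop 0] with N hN
    have hN' : (0 : ℝ) < N := by exact_mod_cast hN
    have h1 : (N : ℝ) / (n + l : ℕ) ≤ ((N / (n + l) : ℕ) : ℝ) + 1 := by
      rw [div_le_iff₀ hL]
      exact_mod_cast (Nat.lt_mul_of_div_lt (Nat.lt_succ_self (N / (n + l))) (by omega)).le
    have h2 := mul_le_mul_of_nonneg_left h1 hαn.le
    have h3 := (hsum N).trans (hbound N)
    rw [le_div_iff₀ hN', add_mul, div_mul_cancel₀ _ hN'.ne', div_mul_eq_mul_div,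
      ← mul_div_assoc']
    linarith
  have h1 := le_of_tendsto_of_tendsto (tendsto_const_nhds.add hω)
    (tendsto_const_div_atTop_nhds_zero_nat (α ^ n + k + 2)) hle
  rw [add_zero] at h1
  exact absurd h1 (not_le.2 (div_pos hαn hL))

theorem expectation_meanPayoff (G : MDP S) (π : G.Strategy) (s : S) (r : S → ℝ) :
    G.expectation π s (meanPayoff r) = ((∫ ω, limAvg r ω ∂G.playMeasure π s : ℝ) : EReal) :=
  if_pos (ae_of_all _ fun _ => WithBot.coe_ne_bot)

theorem expectation_meanPayoffParity (G : MDP S) (π : G.Strategy) (s : S) (p : S → ℕ) (r : S → ℝ)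
    (h : ∀ᵐ ω ∂G.playMeasure π s, Even (minPriority p (infStates ω))) :
    G.expectation π s (meanPayoffParity p r) =
      ((∫ ω, limAvg r ω ∂G.playMeasure π s : ℝ) : EReal) := by
  have heq : ∀ᵐ ω ∂G.playMeasure π s, meanPayoffParity p r ω = meanPayoff r ω :=
    h.mono fun ω hω => if_pos hω
  rw [expectation, if_pos (heq.mono fun ω hω => hω ▸ WithBot.coe_ne_bot)]
  congr 1
  exact integral_congr_ae (heq.mono fun ω hω => by simp only [hω]; rfl)

theorem integrable_limAvg (G : MDP S) (π : G.Strategy) (s : S) (r : S → ℝ) :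
    Integrable (limAvg r) (G.playMeasure π s) := by
  obtain ⟨R, -, hR⟩ := exists_abs_le r
  exact integrable_of_abs_le (measurable_limAvg r) (abs_limAvg_le hR)

theorem value_meanPayoff_le (G : MDP S) {r h : S → ℝ} {v : ℝ}
    (hv : ∀ s, r s + G.best h s ≤ v + h s) (s : S) : G.value (meanPayoff r) s ≤ v := by
  refine iSup_le fun π => ?_
  rw [expectation_meanPayoff, EReal.coe_le_coe_iff]
  refine (integral_mono_ae (G.integrable_limAvg π s r) (integrable_const v)
    (G.ae_limAvg_le hv π s)).trans_eq ?_
  simp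

end LongRun

end MDP

end MPP

/-! ### Choice of parameters and conclusion. -/

theorem mainTheorem4 {S : Type*} [Fintype S] [MeasurableSpace S] [DiscreteMeasurableSpace S]
    (G : MPP.MDP S) (p : S → ℕ) (r : S → ℝ)
    (hG : G.IsEndComponent Set.univ) (hp : Even (MPP.minPriority p Set.univ))
    (ε : ℝ) (hε : 0 < ε) :
    ∃ π : G.Strategy,
      π.IsFiniteMemory ∧
      (∃ (l : ℕ) (σ τ : G.PureMemoryless),
        0 < l ∧ π = MPP.MDP.roundStrategy (Fintype.card S) l σ τ) ∧
      ∀ s : S, G.value (MPP.meanPayoff r) s - (ε : EReal) ≤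
        G.expectation π s (MPP.meanPayoffParity p r) := by
  open MPP MPP.MDP in
  have hE : ∀ s t, Relation.TransGen G.E s t := fun s t =>
    (hG.2.2 s (Set.mem_univ s) t (Set.mem_univ t)).lift id fun _ _ h => h.2.2
  obtain ⟨v, h, hvh⟩ := G.exists_approx_optimality_equation hE r (ε := ε / 4) (by linarith)
  obtain ⟨τ, hτ⟩ := G.exists_mean_law_eq_best h
  obtain ⟨x, -, hx⟩ := Nat.sInf_mem (s := p '' Set.univ) ⟨p G.init, G.init, Set.mem_univ _, rfl⟩
  obtain ⟨d, hdn, hd⟩ := exists_distance hE x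
  have hm : ∀ s, ∃ t, G.E s t ∧ (s ≠ x → d t + 1 = d s) := by
    intro s
    by_cases hs : s = x
    · exact (G.exists_edge s).imp fun t ht => ⟨ht, fun h => absurd hs h⟩
    · exact (hd s hs).imp fun t ht => ⟨ht.1, fun _ => ht.2⟩
  choose m hmE hmd using hm
  obtain ⟨σ, hσ⟩ := G.exists_edge_lower_bound m hmE
  obtain ⟨α, hα0, hα1, hα⟩ := G.exists_lower_bound
  obtain ⟨R, hR0, hR⟩ := exists_abs_le r
  obtain ⟨H, hH0, hH⟩ := exists_abs_le h
  set n := Fintype.card S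
  -- The most by which an arbitrary move can miss the optimality equation.
  set D := |v| + R + 2 * H
  have hD : 0 ≤ D := by positivity
  -- This makes the `σ` phases cost at most ε / 4 on average. With ε / 4 from the equation on each
  -- side, the total loss is 3ε / 4.
  set l := ⌈4 * D * n / ε⌉₊ + 1
  have hl : 0 < l := Nat.succ_pos _
  have hL : (0 : ℝ) < (n + l : ℕ) := by exact_mod_cast Nat.add_pos_right n hl
  have hloss : D * (n / (n + l : ℕ)) ≤ ε / 4 := by
    have h1 : 4 * D * n / ε ≤ (n + l : ℕ) :=
      (Nat.le_ceil _).trans (Nat.cast_le.2 (by omega))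
    rw [div_le_iff₀ hε] at h1
    rw [← mul_div_assoc, div_le_iff₀ hL]
    linarith
  refine ⟨roundStrategy n l σ τ, G.isFiniteMemory_roundStrategy (Nat.add_pos_right n hl) σ τ,
    ⟨l, σ, τ, hl, rfl⟩, fun s => ?_⟩
  have hupper : G.value (meanPayoff r) s ≤ ((v + ε / 4 : ℝ) : EReal) :=
    G.value_meanPayoff_le (h := h) (fun t => by linarith [(abs_le.1 (hvh t)).2]) s
  have hlower := G.ae_le_limAvg_roundStrategy (r := r) (h := h) (v := v - ε / 4) hD
    (Nat.add_pos_right n hl) (σ := σ) (τ := τ)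
    (fun t => by linarith [(abs_le.1 (hvh t)).1, hτ t])
    (fun t => by
      have h1 := (abs_le.1 (hR t)).1
      have h2 := (abs_le.1 (hH t)).2
      have h3 : -H ≤ mean (σ.law t) h := le_mean fun u => (abs_le.1 (hH u)).1
      have h4 := le_abs_self v
      simp only [D]
      linarith) s
  have heven : ∀ᵐ ω ∂G.playMeasure (roundStrategy n l σ τ) s,
      Even (minPriority p (infStates ω)) := by
    filter_upwards [G.ae_mem_infStates_roundStrategy hl (τ := τ) hdn hmd hα0 hα1
      (hσ α hα1 hα) s] with ω hω
    rwa [minPriority_eq_of_mem p hω hx]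
  rw [expectation_meanPayoffParity _ _ _ _ _ heven]
  have hint : v - ε / 2 ≤ ∫ ω, limAvg r ω ∂G.playMeasure (roundStrategy n l σ τ) s := by
    have h1 := integral_mono_ae (integrable_const (v - ε / 2)) (G.integrable_limAvg _ s r)
      (hlower.mono fun ω hω => by
        change v - ε / 2 ≤ limAvg r ω
        linarith)
    simpa using h1
  refine (EReal.sub_le_sub hupper le_rfl).trans ?_
  rw [← EReal.coe_sub, EReal.coe_le_coe_iff]
  linarith
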